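/- Let $\mathcal H,\mathcal K$ be complex Hilbert spaces and let $\Phi:\mathcal B(\mathcal H)\to\mathcal B(\mathcal K)$ be a positive unital linear map, i.e. $\Phi$ is linear, $\Phi(X)\ge 0$ whenever $X\ge 0$, and $\Phi(I)=I$. For $\nu\in[0,1]$ and positive invertible operators $A,B$ put $$A\nabla_\nu B=(1-\nu)A+\nu B,\qquad A\#_\nu B=A^{1/2}\left(A^{-1/2}BA^{-1/2}\right)^{\nu}A^{1/2},$$ and for $t>0$ let $K(t)=\frac{(t+1)^2}{4t}$. Inequalities between operators are in the Loewner order, scalars stand for multiples of $I$, and $\Phi^p(X)$ denotes $(\Phi(X))^p$. Suppose that $A,B\in\mathcal B(\mathcal H)$ and real numbers $m,m',M',M$ satisfy $$0<m\le B\le m'<M'\le A\le M\quad\text{or}\quad 0<m\le A\le m'<M'\le B\le M .$$ Then for every real $p$ with $2\le p<\infty$ and every $\nu\in[0,1]$, $$\Phi^p(A\nabla_\nu B)\le\left(\frac{K(h)}{4^{\frac2p-1}K^{r}(h')}\right)^{p}\Phi^p(A\#_\nu B)$$ and $$\Phi^p(A\nabla_\nu B)\le\left(\frac{K(h)}{4^{\frac2p-1}K^{r}(h')}\right)^{p}\left(\Phi(A)\#_\nu\Phi(B)\right)^p,$$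 where $r=\min\{\nu,1-\nu\}$, $h=\frac Mm$, $h'=\frac{M'}{m'}$, and $K^r(h')=(K(h'))^r$. -/

import Mathlib

noncomputable section

/-- The Kantorovich constant `K(h) = (h + 1)² / (4 h)`. -/
def kantorovich (h : ℝ) : ℝ := (h + 1) ^ 2 / (4 * h)

variable {H : Type*} [NormedAddCommGroup H] [InnerProductSpace ℂ H]

/-- The weighted arithmetic mean `A ∇_ν B = (1 - ν) A + ν B`. -/
def wArithMean (ν : ℝ) (A B : H →L[ℂ] H) : H →L[ℂ] H :=
  (1 - ν) • A + ν • B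

/-- The weighted geometric mean `A #_ν B = A^{1/2} (A^{-1/2} B A^{-1/2})^ν A^{1/2}`
of positive invertible operators. Real powers are those of the continuous functional calculus,
and the order on `H →L[ℂ] H` is the Loewner order. -/
def wGeomMean [CompleteSpace H] (ν : ℝ) (A B : H →L[ℂ] H) : H →L[ℂ] H :=
  A ^ (1 / 2 : ℝ) * (A ^ (-1 / 2 : ℝ) * B * A ^ (-1 / 2 : ℝ)) ^ ν * A ^ (1 / 2 : ℝ)

end

/-! Write `P = Φ(A ∇ B)`, `k = K(h')^r`, and let `G` be `Φ(A # B)` or `Φ(A) # Φ(B)`. Both estimates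
follow from one linear inequality, `P + m M k G⁻¹ ≤ m + M`. To obtain it, `(x - m)(M - x) ≥ 0` gives
`Φ(X) + m M Φ(X⁻¹) ≤ m + M` for `X = A, B` (`map_add_smul_map_inv_le`), while the refined Young
inequality (`smul_wGeomMean_inv_le`) and Choi's inequality (`map_rpow_neg_one_le`) give `k G⁻¹ ≤ (1
- ν) Φ(A⁻¹) + ν Φ(B⁻¹)`. To reach `p`-th powers, divide by `m + M`, so that two positive operators
have sum at most `1`. Their powers of exponent `q = p / 2 ≥ 1` still do, and `norm_mul_le_quarter`
bounds the norm of the product of these powers by `1/4`. This bounds `‖P ^ q G ^ (-q)‖`, and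
squaring yields the claim; the resulting `1/16` is the source of `4 ^ (2/p)`. -/

open scoped InnerProductSpace

/-! ### Quadratic forms and the bound `‖X Y‖ ≤ 1/4`. -/

open ContinuousLinearMap in
theorem re_inner_nonneg_of_nonneg {H : Type*} [NormedAddCommGroup H] [InnerProductSpace ℂ H]
    {X : H →L[ℂ] H} (hX : 0 ≤ X) (u : H) : 0 ≤ (⟪X u, u⟫_ℂ).re :=
  ((nonneg_iff_isPositive X).1 hX).re_inner_nonneg_left u

open ContinuousLinearMap in
theorem inner_apply_comm_of_nonneg {H : Type*} [NormedAddCommGroup H] [InnerProductSpace ℂ H]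
    {X : H →L[ℂ] H} (hX : 0 ≤ X) (u v : H) : ⟪X u, v⟫_ℂ = ⟪u, X v⟫_ℂ :=
  ((nonneg_iff_isPositive X).1 hX).inner_left_eq_inner_right u v

theorem re_inner_le_of_le {H : Type*} [NormedAddCommGroup H] [InnerProductSpace ℂ H]
    {X Y : H →L[ℂ] H} (h : X ≤ Y) (u : H) : (⟪X u, u⟫_ℂ).re ≤ (⟪Y u, u⟫_ℂ).re := by
  have := ((ContinuousLinearMap.le_def X Y).1 h).re_inner_nonneg_left u
  simp only [sub_apply, inner_sub_left, RCLike.re_eq_complex_re, Complex.sub_re] at this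
  linarith

theorem re_inner_self_eq_norm_sq {H : Type*} [NormedAddCommGroup H] [InnerProductSpace ℂ H]
    (u : H) : (⟪u, u⟫_ℂ).re = ‖u‖ ^ 2 := by
  simpa using inner_self_eq_norm_sq (𝕜 := ℂ) u

theorem re_inner_comm {H : Type*} [NormedAddCommGroup H] [InnerProductSpace ℂ H]
    (u v : H) : (⟪u, v⟫_ℂ).re = (⟪v, u⟫_ℂ).re := by
  simpa using inner_re_symm (𝕜 := ℂ) u v

/-- If `X, Y ≥ 0` and `X + Y ≤ 1` then the row operator `(X, Y)` is bounded by the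
quadratic form of `X ⊕ Y`. -/
theorem norm_apply_add_apply_sq_le {H : Type*} [NormedAddCommGroup H] [InnerProductSpace ℂ H]
    {X Y : H →L[ℂ] H} (hX : 0 ≤ X) (hY : 0 ≤ Y) (hXY : X + Y ≤ 1) (v u : H) :
    ‖X v + Y u‖ ^ 2 ≤ (⟪X v, v⟫_ℂ).re + (⟪Y u, u⟫_ℂ).re := by
  set f := X v + Y u with hf
  -- Summing the forms of `X` at `v - f` and `Y` at `u - f`, the cross terms give `-2‖f‖²` and the
  -- terms in `f` alone at most `‖f‖²`.
  have h1 := re_inner_nonneg_of_nonneg hX (v - f)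
  have h2 := re_inner_nonneg_of_nonneg hY (u - f)
  have h3 := re_inner_le_of_le hXY f
  have h4 : (⟪X v, f⟫_ℂ).re + (⟪Y u, f⟫_ℂ).re = ‖f‖ ^ 2 := by
    rw [← re_inner_self_eq_norm_sq, ← Complex.add_re, ← inner_add_left]
  have h5 : (⟪X f, v⟫_ℂ).re = (⟪X v, f⟫_ℂ).re := by
    rw [inner_apply_comm_of_nonneg hX, re_inner_comm]
  have h6 : (⟪Y f, u⟫_ℂ).re = (⟪Y u, f⟫_ℂ).re := by
    rw [inner_apply_comm_of_nonneg hY, re_inner_comm]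
  simp only [map_sub, inner_sub_left, inner_sub_right, Complex.sub_re,
    add_apply, inner_add_left, Complex.add_re,
    one_apply_eq_self, re_inner_self_eq_norm_sq] at h1 h2 h3
  linarith

/-- The parallelogram-type bound `4 re ⟪S z, w⟫ ≤ ‖z + w‖²` for `0 ≤ S ≤ 1`. -/
theorem four_mul_re_inner_le {H : Type*} [NormedAddCommGroup H] [InnerProductSpace ℂ H]
    {S : H →L[ℂ] H} (hS : 0 ≤ S) (hS1 : S ≤ 1) (z w : H) :
    4 * (⟪S z, w⟫_ℂ).re ≤ ‖z + w‖ ^ 2 := by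
  -- Polarization: `4 re ⟪S z, w⟫` is the form of `S` at `z + w` minus that at `z - w`.
  have h1 := re_inner_nonneg_of_nonneg hS (z - w)
  have h2 := re_inner_le_of_le hS1 (z + w)
  have h5 : (⟪S w, z⟫_ℂ).re = (⟪S z, w⟫_ℂ).re := by
    rw [inner_apply_comm_of_nonneg hS, re_inner_comm]
  simp only [one_apply_eq_self, re_inner_self_eq_norm_sq] at h2
  simp only [map_sub, map_add, inner_sub_left, inner_sub_right, Complex.sub_re,
    inner_add_left, inner_add_right, Complex.add_re] at h1 h2
  linarith

theorem norm_apply_le_of_nonneg_of_le_one {H : Type*} [NormedAddCommGroup H]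
    [InnerProductSpace ℂ H] {X : H →L[ℂ] H} (hX : 0 ≤ X) (hX1 : X ≤ 1) (v : H) :
    ‖X v‖ ^ 2 ≤ (⟪X v, v⟫_ℂ).re := by
  simpa using norm_apply_add_apply_sq_le hX le_rfl (by simpa using hX1) v (0 : H)

theorem norm_apply_le_norm_of_nonneg_of_le_one {H : Type*} [NormedAddCommGroup H]
    [InnerProductSpace ℂ H] {X : H →L[ℂ] H} (hX : 0 ≤ X) (hX1 : X ≤ 1) (v : H) :
    ‖X v‖ ≤ ‖v‖ := by
  have h1 := norm_apply_le_of_nonneg_of_le_one hX hX1 v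
  have h2 := re_inner_le_of_le hX1 v
  simp only [one_apply_eq_self, re_inner_self_eq_norm_sq] at h2
  exact (sq_le_sq₀ (norm_nonneg _) (norm_nonneg _)).1 (h1.trans h2)

/-- The estimate behind the arithmetic-geometric mean inequality for `‖X Y‖`, evaluated at an
approximate singular pair `(u, X Y u)` of `X Y`. -/
theorem mul_sq_le_of_singular_vector {H : Type*} [NormedAddCommGroup H]
    [InnerProductSpace ℂ H] [CompleteSpace H] {X Y : H →L[ℂ] H} (hX : 0 ≤ X) (hY : 0 ≤ Y)
    (hXY : X + Y ≤ 1) {l : ℝ} (hl : 1 / 4 ≤ l) (u : H) (hu : ‖u‖ ≤ 1)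
    (hn : ‖X * Y‖ = l) :
    (l - 1 / 4) * (‖X (Y u)‖ ^ 2 / l) ^ 2 ≤ √(l ^ 2 - ‖X (Y u)‖ ^ 2) := by
  have hl0 : 0 < l := by linarith
  have hX1 : X ≤ 1 := le_trans (le_add_of_nonneg_right hY) hXY
  have hY1 : Y ≤ 1 := le_trans (le_add_of_nonneg_left hX) hXY
  set w := X (Y u) with hw
  set v : H := ((l⁻¹ : ℝ) : ℂ) • w with hv
  have hlv : ((l : ℝ) : ℂ) • v = w := by
    rw [hv, smul_smul, ← Complex.ofReal_mul, mul_inv_cancel₀ hl0.ne']; simp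
  have hvw : ‖v‖ = l⁻¹ * ‖w‖ := by
    rw [hv, norm_smul]; simp [abs_of_pos hl0]
  -- The defect of the singular pair: `e = 0` if `u` is a unit vector at which `X * Y` attains its
  -- norm.
  set e : H := Y (X v) - ((l : ℝ) : ℂ) • u with he
  have hin : (⟪Y (X v), u⟫_ℂ).re = ‖w‖ ^ 2 / l := by
    rw [inner_apply_comm_of_nonneg hY, inner_apply_comm_of_nonneg hX, ← hw, hv, inner_smul_left]
    simp only [Complex.conj_ofReal, Complex.re_ofReal_mul, re_inner_self_eq_norm_sq]
    field_simp
  have hwl : ‖w‖ ≤ l := by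
    have := (X * Y).le_opNorm u
    rw [hn] at this
    calc ‖w‖ ≤ l * ‖u‖ := this
      _ ≤ l * 1 := by gcongr
      _ = l := mul_one l
  have hTv : ‖Y (X v)‖ ≤ ‖w‖ := by
    have hadj : star (X * Y) = Y * X := by
      rw [star_mul, (IsSelfAdjoint.of_nonneg hX).star_eq, (IsSelfAdjoint.of_nonneg hY).star_eq]
    have := (Y * X).le_opNorm v
    rw [← hadj, norm_star, hn, hadj, hvw, ← mul_assoc, mul_inv_cancel₀ hl0.ne', one_mul] at this
    exact this
  have hesq : ‖e‖ ^ 2 ≤ l ^ 2 - ‖w‖ ^ 2 := by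
    have h1 : ‖e‖ ^ 2 = ‖Y (X v)‖ ^ 2 - 2 * l * (⟪Y (X v), u⟫_ℂ).re + l ^ 2 * ‖u‖ ^ 2 := by
      have h2 : (⟪u, Y (X v)⟫_ℂ).re = (⟪Y (X v), u⟫_ℂ).re := re_inner_comm _ _
      rw [← re_inner_self_eq_norm_sq, he]
      simp only [inner_sub_left, inner_sub_right, inner_smul_left, inner_smul_right,
        Complex.sub_re, Complex.conj_ofReal, Complex.re_ofReal_mul, re_inner_self_eq_norm_sq, h2]
      ring
    have h3 : 2 * l * (‖w‖ ^ 2 / l) = 2 * ‖w‖ ^ 2 := by field_simp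
    have h4 : ‖Y (X v)‖ ^ 2 ≤ ‖w‖ ^ 2 := by gcongr
    have h5 : l ^ 2 * ‖u‖ ^ 2 ≤ l ^ 2 * 1 ^ 2 := by gcongr
    rw [h1, hin, h3]; linarith
  have he' : ‖e‖ ≤ √(l ^ 2 - ‖w‖ ^ 2) := Real.le_sqrt_of_sq_le hesq
  have hYX : Y (X v) = ((l : ℝ) : ℂ) • u + e := by rw [he]; abel
  set a := (⟪X v, v⟫_ℂ).re with ha
  set b := (⟪Y u, u⟫_ℂ).re with hb
  have hYu : ‖Y u‖ ≤ 1 := (norm_apply_le_norm_of_nonneg_of_le_one hY hY1 u).trans hu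
  -- With `e = 0` this quantity is `l (a + b)`; four times it is at most `‖Y u + X v‖² ≤ a + b`,
  -- which would force `l ≤ 1/4`.
  have h1 : (⟪(X + Y) (Y u), X v⟫_ℂ).re = l * (a + b) + (⟪Y u, e⟫_ℂ).re := by
    rw [add_apply, inner_add_left, ← hw, ← hlv,
      inner_apply_comm_of_nonneg hY (Y u), hYX, inner_add_right, inner_smul_right,
      inner_smul_left, Complex.conj_ofReal, Complex.add_re, Complex.add_re,
      Complex.re_ofReal_mul, Complex.re_ofReal_mul, re_inner_comm v]
    ring
  have h2 := four_mul_re_inner_le (add_nonneg hX hY) hXY (Y u) (X v)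
  have h3 := norm_apply_add_apply_sq_le hX hY hXY v u
  rw [add_comm (X v)] at h3
  have h4 : -‖e‖ ≤ (⟪Y u, e⟫_ℂ).re := by
    have h := (Complex.abs_re_le_norm _).trans (norm_inner_le_norm (𝕜 := ℂ) (Y u) e)
    have h' : ‖Y u‖ * ‖e‖ ≤ 1 * ‖e‖ := by gcongr
    linarith [(abs_le.1 (h.trans h')).1]
  -- Keeps `a + b` away from `0`, so that a small defect cannot be absorbed.
  have h5 : (‖w‖ ^ 2 / l) ^ 2 ≤ a := by
    have h6 : ‖w‖ ^ 2 / l ≤ ‖Y (X v)‖ := by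
      rw [← hin]
      refine ((le_abs_self _).trans (Complex.abs_re_le_norm _)).trans
        ((norm_inner_le_norm _ _).trans ?_)
      calc ‖Y (X v)‖ * ‖u‖ ≤ ‖Y (X v)‖ * 1 := by gcongr
        _ = _ := mul_one _
    have h7 := h6.trans (norm_apply_le_norm_of_nonneg_of_le_one hY hY1 (X v))
    calc (‖w‖ ^ 2 / l) ^ 2 ≤ ‖X v‖ ^ 2 := by gcongr
      _ ≤ a := norm_apply_le_of_nonneg_of_le_one hX hX1 v
  have hb0 : 0 ≤ b := re_inner_nonneg_of_nonneg hY u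
  have h8 : (l - 1 / 4) * (‖w‖ ^ 2 / l) ^ 2 ≤ (l - 1 / 4) * (a + b) := by
    have : 0 ≤ l - 1 / 4 := by linarith
    gcongr
    linarith
  linarith

/-- The arithmetic-geometric mean inequality of Bhatia and Kittaneh, for the operator norm. -/
theorem norm_mul_le_quarter {H : Type*} [NormedAddCommGroup H]
    [InnerProductSpace ℂ H] [CompleteSpace H] {X Y : H →L[ℂ] H} (hX : 0 ≤ X) (hY : 0 ≤ Y)
    (hXY : X + Y ≤ 1) : ‖X * Y‖ ≤ 1 / 4 := by
  by_contra! hcon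
  set l := ‖X * Y‖ with hl
  have hl0 : 0 < l := by linarith
  -- The norm need not be attained, so `c` increases to `l`: the right side tends to `0`, the left
  -- to `(l - 1/4) l² > 0`.
  have hle : ∀ c ∈ Set.Ioo 0 l, (l - 1 / 4) * (c ^ 2 / l) ^ 2 ≤ √(l ^ 2 - c ^ 2) := by
    intro c hc
    obtain ⟨u, hu, hcu⟩ := (X * Y).exists_lt_apply_of_lt_opNorm hc.2
    have hcu' : c < ‖X (Y u)‖ := hcu
    have h := mul_sq_le_of_singular_vector hX hY hXY hcon.le u hu.le hl.symm
    have hc0 := hc.1.le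
    have h0 : 0 ≤ l - 1 / 4 := by linarith
    calc (l - 1 / 4) * (c ^ 2 / l) ^ 2 ≤ (l - 1 / 4) * (‖X (Y u)‖ ^ 2 / l) ^ 2 := by gcongr
      _ ≤ √(l ^ 2 - ‖X (Y u)‖ ^ 2) := h
      _ ≤ √(l ^ 2 - c ^ 2) := by gcongr
  have hmem : Set.Ioo 0 l ∈ nhdsWithin l (Set.Iio l) := Ioo_mem_nhdsLT hl0
  have h1 : Filter.Tendsto (fun c : ℝ => (l - 1 / 4) * (c ^ 2 / l) ^ 2) (nhdsWithin l (Set.Iio l))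
      (nhds ((l - 1 / 4) * (l ^ 2 / l) ^ 2)) :=
    (Continuous.tendsto (by fun_prop) l).mono_left nhdsWithin_le_nhds
  have h2 : Filter.Tendsto (fun c : ℝ => √(l ^ 2 - c ^ 2)) (nhdsWithin l (Set.Iio l))
      (nhds (√(l ^ 2 - l ^ 2))) :=
    (Continuous.tendsto (by fun_prop) l).mono_left nhdsWithin_le_nhds
  have h3 := le_of_tendsto_of_tendsto h1 h2 (Filter.eventually_of_mem hmem hle)
  rw [sub_self, Real.sqrt_zero] at h3
  have : 0 < (l - 1 / 4) * (l ^ 2 / l) ^ 2 := mul_pos (by linarith) (by positivity)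
  linarith

/-! ### Real powers in a C⋆-algebra and the passage to `p`-th powers. -/

section CStar

variable {𝔄 : Type*} [CStarAlgebra 𝔄] [PartialOrder 𝔄] [StarOrderedRing 𝔄]

theorem spectrum_subset_Icc_iff {a : 𝔄} (ha : IsSelfAdjoint a) {m M : ℝ} :
    (m • (1 : 𝔄) ≤ a ∧ a ≤ M • (1 : 𝔄)) ↔ spectrum ℝ a ⊆ Set.Icc m M := by
  rw [← Algebra.algebraMap_eq_smul_one, ← Algebra.algebraMap_eq_smul_one,
    algebraMap_le_iff_le_spectrum, le_algebraMap_iff_spectrum_le]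
  exact ⟨fun h x hx => ⟨h.1 x hx, h.2 x hx⟩, fun h => ⟨fun x hx => (h hx).1, fun x hx => (h hx).2⟩⟩

theorem isStrictlyPositive_smul_one {m : ℝ} (hm : 0 < m) : IsStrictlyPositive (m • (1 : 𝔄)) :=
  .smul hm ⟨zero_le_one, isUnit_one⟩

theorem isStrictlyPositive_of_smul_one_le {a : 𝔄} {m : ℝ} (hm : 0 < m) (h : m • (1 : 𝔄) ≤ a) :
    IsStrictlyPositive a :=
  (isStrictlyPositive_smul_one hm).of_le h

theorem IsStrictlyPositive.pos_of_mem_spectrum {a : 𝔄} (ha : IsStrictlyPositive a) {x : ℝ}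
    (hx : x ∈ spectrum ℝ a) : 0 < x :=
  (spectrum_nonneg_of_nonneg ha.nonneg hx).lt_of_ne
    (fun h => (spectrum.zero_notMem ℝ ha.isUnit) (h ▸ hx))

theorem IsStrictlyPositive.continuousOn_rpow {a : 𝔄} (ha : IsStrictlyPositive a) (y : ℝ) :
    ContinuousOn (fun x : ℝ => x ^ y) (spectrum ℝ a) :=
  fun x hx => (Real.continuousAt_rpow_const x y
    (.inl (ha.pos_of_mem_spectrum hx).ne')).continuousWithinAt

theorem IsStrictlyPositive.smul_rpow {a : 𝔄} (ha : IsStrictlyPositive a) {r : ℝ} (hr : 0 < r)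
    (y : ℝ) : (r • a) ^ y = r ^ y • a ^ y := by
  have hsa : IsSelfAdjoint a := .of_nonneg ha.nonneg
  have h1 : r • a = cfc (fun x : ℝ => r * x) a := by
    rw [cfc_const_mul_id r a]
  rw [h1, CFC.cfc_rpow (fun x hx => mul_pos hr (ha.pos_of_mem_spectrum hx)),
    CFC.rpow_eq_cfc_real ha.nonneg, ← cfc_smul _ _ _ (ha.continuousOn_rpow y)]
  exact cfc_congr fun x hx => Real.mul_rpow hr.le (ha.pos_of_mem_spectrum hx).le

theorem IsStrictlyPositive.rpow_le_self {a : 𝔄} (ha : IsStrictlyPositive a) (ha1 : a ≤ 1) {q : ℝ}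
    (hq : 1 ≤ q) : a ^ q ≤ a := by
  have hsa : IsSelfAdjoint a := .of_nonneg ha.nonneg
  conv_rhs => rw [← cfc_id' ℝ a]
  rw [CFC.rpow_eq_cfc_real ha.nonneg]
  refine cfc_mono (fun x hx => ?_) (ha.continuousOn_rpow q)
  have hx1 : x ≤ 1 := (le_algebraMap_iff_spectrum_le (r := (1 : ℝ)) hsa).1 (by simpa using ha1) x hx
  simpa using Real.rpow_le_rpow_of_exponent_ge (ha.pos_of_mem_spectrum hx) hx1 hq

/-- On the spectrum, `(x - m)(M - x) / x ≥ 0`. -/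
theorem add_smul_rpow_neg_one_le {a : 𝔄} {m M : ℝ} (hm : 0 < m) (h : m • (1 : 𝔄) ≤ a)
    (h' : a ≤ M • (1 : 𝔄)) : a + (m * M) • a ^ (-1 : ℝ) ≤ (m + M) • (1 : 𝔄) := by
  have ha := isStrictlyPositive_of_smul_one_le hm h
  have hsa : IsSelfAdjoint a := .of_nonneg ha.nonneg
  have hsp := (spectrum_subset_Icc_iff hsa).1 ⟨h, h'⟩
  have hc := ha.continuousOn_rpow (-1)
  have hcs : ContinuousOn (fun x : ℝ => (m * M) • x ^ (-1 : ℝ)) (spectrum ℝ a) := by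
    fun_prop
  have h1 : a + (m * M) • a ^ (-1 : ℝ) = cfc (fun x : ℝ => x + (m * M) • x ^ (-1 : ℝ)) a := by
    rw [cfc_add a _ _ (continuousOn_id' _) hcs, cfc_id' ℝ a, cfc_smul _ _ _ hc,
      CFC.rpow_eq_cfc_real ha.nonneg]
  rw [h1, ← Algebra.algebraMap_eq_smul_one]
  refine cfc_le_algebraMap _ _ _ (fun x hx => ?_) ((continuousOn_id' _).add hcs)
  obtain ⟨h2, h3⟩ := hsp hx
  have hx0 := ha.pos_of_mem_spectrum hx
  rw [Real.rpow_neg_one, smul_eq_mul, ← div_eq_mul_inv, ← sub_nonneg]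
  have : m + M - (x + m * M / x) = (x - m) * (M - x) / x := by field_simp; ring
  rw [this]
  exact div_nonneg (mul_nonneg (by linarith) (by linarith)) hx0.le

/-- For `T = P ^ q * G ^ (-q)`, conjugate `T⋆ T ≤ k²` by `G ^ q`. -/
theorem rpow_le_smul_rpow_of_norm_mul_le {P G : 𝔄} (hP : IsStrictlyPositive P)
    (hG : IsStrictlyPositive G) {k q : ℝ} (h : ‖P ^ q * G ^ (-q)‖ ≤ k) :
    P ^ (q + q) ≤ k ^ 2 • G ^ (q + q) := by
  have h1 : star (P ^ q * G ^ (-q)) * (P ^ q * G ^ (-q)) ≤ algebraMap ℝ 𝔄 (k ^ 2) :=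
    CStarAlgebra.star_mul_le_algebraMap_norm_sq.trans (algebraMap_mono _ (by gcongr))
  have hconj := conjugate_le_conjugate_of_nonneg h1 (c := G ^ q) CFC.rpow_nonneg
  have hPsa : star (P ^ q) = P ^ q := (IsSelfAdjoint.of_nonneg CFC.rpow_nonneg).star_eq
  have hGsa : star (G ^ (-q)) = G ^ (-q) := (IsSelfAdjoint.of_nonneg CFC.rpow_nonneg).star_eq
  have hL : G ^ q * (star (P ^ q * G ^ (-q)) * (P ^ q * G ^ (-q))) * G ^ q = P ^ (q + q) := by
    rw [star_mul, hPsa, hGsa]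
    calc _ = (G ^ q * G ^ (-q)) * (P ^ q * P ^ q) * (G ^ (-q) * G ^ q) := by
          simp only [mul_assoc]
      _ = _ := by
        rw [CFC.rpow_mul_rpow_neg q hG, CFC.rpow_neg_mul_rpow q hG, CFC.rpow_add hP.isUnit,
          one_mul, mul_one]
  rwa [hL, Algebra.algebraMap_eq_smul_one, mul_smul_comm, smul_mul_assoc, mul_one,
    ← CFC.rpow_add hG.isUnit] at hconj

/-- Both spectra lie in `(0, 1]`, where `x ^ q ≤ x`. With `q = p / 2` this is where `2 ≤ p` enters.
-/
theorem rpow_add_rpow_le_one {X Y : 𝔄} (hX : IsStrictlyPositive X) (hY : IsStrictlyPositive Y)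
    (h : X + Y ≤ 1) {q : ℝ} (hq : 1 ≤ q) : X ^ q + Y ^ q ≤ 1 :=
  (add_le_add (hX.rpow_le_self ((le_add_of_nonneg_right hY.nonneg).trans h) hq)
    (hY.rpow_le_self ((le_add_of_nonneg_left hX.nonneg).trans h) hq)).trans h

theorem norm_smul_rpow_mul_smul_rpow {P G : 𝔄} (hP : IsStrictlyPositive P)
    (hG : IsStrictlyPositive G) {a b : ℝ} (ha : 0 < a) (hb : 0 < b) (q : ℝ) :
    ‖(a • P) ^ q * (b • G ^ (-1 : ℝ)) ^ q‖ = (a * b) ^ q * ‖P ^ q * G ^ (-q)‖ := by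
  rw [hP.smul_rpow ha, (hG.rpow G (-1)).smul_rpow hb, CFC.rpow_rpow G (-1) q (by norm_num) hG,
    neg_one_mul, smul_mul_smul_comm, norm_smul, Real.mul_rpow ha.le hb.le, Real.norm_of_nonneg
    (by positivity)]

end CStar

/-- From `P + c G⁻¹ ≤ s` one obtains an inequality between `p`-th powers, `2 ≤ p`. -/
theorem rpow_le_smul_rpow_of_add_smul_inv_le {H : Type*} [NormedAddCommGroup H]
    [InnerProductSpace ℂ H] [CompleteSpace H] {P G : H →L[ℂ] H} (hP : IsStrictlyPositive P)
    (hG : IsStrictlyPositive G) {c s p : ℝ} (hc : 0 < c) (hs : 0 < s) (hp : 2 ≤ p)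
    (h : P + c • G ^ (-1 : ℝ) ≤ s • (1 : H →L[ℂ] H)) :
    P ^ p ≤ ((s ^ 2 / c) ^ p / 16) • G ^ p := by
  obtain ⟨q, rfl⟩ : ∃ q, p = q + q := ⟨p / 2, by ring⟩
  have hs' : 0 < s⁻¹ := inv_pos.2 hs
  have hcs : 0 < s⁻¹ * c := mul_pos hs' hc
  have hsum : s⁻¹ • P + (s⁻¹ * c) • G ^ (-1 : ℝ) ≤ 1 := by
    have := smul_le_smul_of_nonneg_left h hs'.le
    rwa [smul_add, smul_smul, smul_smul, inv_mul_cancel₀ hs.ne', one_smul] at this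
  have hX : IsStrictlyPositive (s⁻¹ • P) := hP.smul hs'
  have hY : IsStrictlyPositive ((s⁻¹ * c) • G ^ (-1 : ℝ)) := (hG.rpow G (-1)).smul hcs
  have hXq : 0 ≤ (s⁻¹ • P) ^ q := CFC.rpow_nonneg
  have hYq : 0 ≤ ((s⁻¹ * c) • G ^ (-1 : ℝ)) ^ q := CFC.rpow_nonneg
  have hXY := rpow_add_rpow_le_one hX hY hsum (show 1 ≤ q by linarith)
  have hn := norm_mul_le_quarter hXq hYq hXY
  rw [norm_smul_rpow_mul_smul_rpow hP hG hs' hcs] at hn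
  have hd : s⁻¹ * (s⁻¹ * c) = (s ^ 2 / c)⁻¹ := by field_simp
  have hd0 : 0 < s ^ 2 / c := by positivity
  rw [hd, Real.inv_rpow hd0.le, inv_mul_le_iff₀ (by positivity)] at hn
  have := rpow_le_smul_rpow_of_norm_mul_le hP hG hn
  rwa [show ((s ^ 2 / c) ^ q * (1 / 4)) ^ 2 = (s ^ 2 / c) ^ (q + q) / 16 by
    rw [Real.rpow_add hd0]; ring] at this

/-! ### The scalar Young inequality with Kantorovich constant. -/

/-- Since `K(x) x = ((1 + x) / 2)²`, this is weighted AM-GM for `(1 + x) / 2` and `1` when `ν ≤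
1/2`, and for `(1 + x) / 2` and `x` otherwise. -/
theorem kantorovich_mul_rpow_le {x ν : ℝ} (hx : 0 < x) (hν : ν ∈ Set.Icc (0 : ℝ) 1) :
    kantorovich x ^ min ν (1 - ν) * x ^ ν ≤ 1 - ν + ν * x := by
  have hK : kantorovich x * x = ((1 + x) / 2) ^ (2 : ℝ) := by
    rw [kantorovich, Real.rpow_two]; field_simp; ring
  have hK0 : 0 < kantorovich x := by rw [kantorovich]; positivity
  have h0 : 0 < (1 + x) / 2 := by positivity
  rcases le_total ν (1 - ν) with h | h
  · rw [min_eq_left h, ← Real.mul_rpow hK0.le hx.le, hK, ← Real.rpow_mul h0.le]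
    have := Real.geom_mean_le_arith_mean2_weighted (w₁ := 2 * ν) (w₂ := 1 - 2 * ν)
      (by linarith [hν.1]) (by linarith) h0.le zero_le_one (by ring)
    rw [Real.one_rpow, mul_one] at this
    linarith
  · rw [min_eq_right h]
    have := Real.geom_mean_le_arith_mean2_weighted (w₁ := 2 * (1 - ν)) (w₂ := 2 * ν - 1)
      (by linarith [hν.2]) (by linarith) h0.le hx.le (by ring)
    rw [Real.rpow_mul h0.le, ← hK, Real.mul_rpow hK0.le hx.le, mul_assoc, ← Real.rpow_add hx,
      show 1 - ν + (2 * ν - 1) = ν by ring] at this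
    linarith

theorem kantorovich_inv {x : ℝ} (hx : x ≠ 0) : kantorovich x⁻¹ = kantorovich x := by
  rw [kantorovich, kantorovich]; field_simp; ring

theorem kantorovich_le_kantorovich {x y : ℝ} (hx : 1 ≤ x) (hxy : x ≤ y) :
    kantorovich x ≤ kantorovich y := by
  have hx0 : 0 < x := by linarith
  have hy0 : 0 < y := by linarith
  rw [kantorovich, kantorovich, div_le_div_iff₀ (by positivity) (by positivity)]
  -- After cross-multiplication the difference is `4 (y - x)(x y - 1)`.
  nlinarith [mul_nonneg (sub_nonneg.2 hxy)
    (sub_nonneg.2 (one_le_mul_of_one_le_of_one_le hx (hx.trans hxy)))]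

/-- The refined Young inequality for `x⁻¹` when `x` lies outside of `(h⁻¹, h)`. -/
theorem kantorovich_mul_rpow_neg_le {x h ν : ℝ} (hx : 0 < x) (hh : 1 ≤ h)
    (hxh : x ≤ h⁻¹ ∨ h ≤ x) (hν : ν ∈ Set.Icc (0 : ℝ) 1) :
    kantorovich h ^ min ν (1 - ν) * x ^ (-ν) ≤ 1 - ν + ν * x ^ (-1 : ℝ) := by
  have hh0 : 0 < h := by linarith
  have h1 : kantorovich h ≤ kantorovich x⁻¹ := by
    rcases hxh with h2 | h2
    · exact kantorovich_le_kantorovich hh ((le_inv_comm₀ hx hh0).1 h2)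
    · rw [kantorovich_inv hx.ne']
      exact kantorovich_le_kantorovich hh h2
  have hK0 : 0 ≤ kantorovich h := by rw [kantorovich]; positivity
  have hr : 0 ≤ min ν (1 - ν) := le_min hν.1 (by linarith [hν.2])
  have := kantorovich_mul_rpow_le (inv_pos.2 hx) hν
  rw [Real.rpow_neg_one, Real.rpow_neg hx.le, ← Real.inv_rpow hx.le]
  refine le_trans ?_ this
  gcongr

/-! ### The refined Young inequality for operators. -/

section Mean

variable {H : Type*} [NormedAddCommGroup H] [InnerProductSpace ℂ H] [CompleteSpace H]

theorem isStrictlyPositive_conj_rpow {A B : H →L[ℂ] H} (hA : IsStrictlyPositive A)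
    (hB : IsStrictlyPositive B) (y : ℝ) : IsStrictlyPositive (A ^ y * B * A ^ y) := by
  refine ⟨conjugate_nonneg_of_nonneg hB.nonneg CFC.rpow_nonneg, ?_⟩
  exact ((hA.rpow A y).isUnit.mul hB.isUnit).mul (hA.rpow A y).isUnit

theorem isStrictlyPositive_wGeomMean {A B : H →L[ℂ] H} (hA : IsStrictlyPositive A)
    (hB : IsStrictlyPositive B) (ν : ℝ) : IsStrictlyPositive (wGeomMean ν A B) :=
  isStrictlyPositive_conj_rpow hA ((isStrictlyPositive_conj_rpow hA hB _).rpow _ ν) _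

theorem rpow_neg_one_eq_of_mul_eq_one {𝔄 : Type*} [CStarAlgebra 𝔄] [PartialOrder 𝔄]
    [StarOrderedRing 𝔄] {G T : 𝔄} (hG : IsStrictlyPositive G) (h : G * T = 1) :
    G ^ (-1 : ℝ) = T := by
  have h1 := CFC.rpow_neg_mul_rpow 1 hG
  rw [CFC.rpow_one G hG.nonneg] at h1
  exact left_inv_eq_right_inv h1 h

theorem conj_rpow_neg_one {𝔄 : Type*} [CStarAlgebra 𝔄] [PartialOrder 𝔄]
    [StarOrderedRing 𝔄] {A C : 𝔄} (hA : IsStrictlyPositive A) (hC : IsStrictlyPositive C)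
    (hAC : IsStrictlyPositive (A ^ (1 / 2 : ℝ) * C * A ^ (1 / 2 : ℝ))) :
    (A ^ (1 / 2 : ℝ) * C * A ^ (1 / 2 : ℝ)) ^ (-1 : ℝ) =
      A ^ (-1 / 2 : ℝ) * C ^ (-1 : ℝ) * A ^ (-1 / 2 : ℝ) := by
  refine rpow_neg_one_eq_of_mul_eq_one hAC ?_
  have h1 : A ^ (1 / 2 : ℝ) * A ^ (-1 / 2 : ℝ) = 1 := by
    rw [neg_div]; exact CFC.rpow_mul_rpow_neg _ hA
  have h2 : C * C ^ (-1 : ℝ) = 1 := by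
    have := CFC.rpow_mul_rpow_neg 1 hC
    rwa [CFC.rpow_one C hC.nonneg] at this
  calc _ = A ^ (1 / 2 : ℝ) * (C * ((A ^ (1 / 2 : ℝ) * A ^ (-1 / 2 : ℝ)) * C ^ (-1 : ℝ))) *
        A ^ (-1 / 2 : ℝ) := by simp only [mul_assoc]
    _ = 1 := by rw [h1, one_mul, h2, mul_one, h1]

theorem wGeomMean_rpow_neg_one {A B : H →L[ℂ] H} (hA : IsStrictlyPositive A)
    (hB : IsStrictlyPositive B) (ν : ℝ) :
    wGeomMean ν A B ^ (-1 : ℝ) = A ^ (-1 / 2 : ℝ) *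
      (A ^ (-1 / 2 : ℝ) * B * A ^ (-1 / 2 : ℝ)) ^ (-ν) * A ^ (-1 / 2 : ℝ) := by
  have hC := isStrictlyPositive_conj_rpow hA hB (-1 / 2)
  have hG : IsStrictlyPositive (wGeomMean ν A B) := isStrictlyPositive_wGeomMean hA hB ν
  rw [wGeomMean] at hG ⊢
  rw [conj_rpow_neg_one hA (hC.rpow _ ν) hG]
  -- `CFC.rpow_rpow` needs a nonzero inner exponent.
  by_cases h : ν = 0
  · rw [h, neg_zero, CFC.rpow_zero _ hC.nonneg, CFC.one_rpow]
  · rw [CFC.rpow_rpow _ ν (-1) h hC, mul_neg_one]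

/-- The spectral form of the refined operator Young inequality. -/
theorem smul_rpow_neg_le {𝔄 : Type*} [CStarAlgebra 𝔄] [PartialOrder 𝔄]
    [StarOrderedRing 𝔄] {C : 𝔄} (hC : IsStrictlyPositive C) {h ν : ℝ} (hh : 1 ≤ h)
    (hCh : C ≤ h⁻¹ • (1 : 𝔄) ∨ h • (1 : 𝔄) ≤ C) (hν : ν ∈ Set.Icc (0 : ℝ) 1) :
    kantorovich h ^ min ν (1 - ν) • C ^ (-ν) ≤ (1 - ν) • (1 : 𝔄) + ν • C ^ (-1 : ℝ) := by
  have hsa : IsSelfAdjoint C := .of_nonneg hC.nonneg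
  have hc := hC.continuousOn_rpow (-1)
  have hcν := hC.continuousOn_rpow (-ν)
  have hcs : ContinuousOn (fun x : ℝ => ν • x ^ (-1 : ℝ)) (spectrum ℝ C) := by
    fun_prop
  have hR : (1 - ν) • (1 : 𝔄) + ν • C ^ (-1 : ℝ) =
      cfc (fun x : ℝ => (1 - ν) + ν • x ^ (-1 : ℝ)) C := by
    rw [cfc_const_add (1 - ν) (fun x : ℝ => ν • x ^ (-1 : ℝ)) C hcs,
      cfc_smul _ _ _ hc, ← CFC.rpow_eq_cfc_real hC.nonneg, Algebra.algebraMap_eq_smul_one]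
  rw [hR, CFC.rpow_eq_cfc_real hC.nonneg, ← cfc_smul _ _ _ hcν]
  refine cfc_mono (fun x hx => ?_) (by fun_prop) (continuousOn_const.add hcs)
  refine kantorovich_mul_rpow_neg_le (hC.pos_of_mem_spectrum hx) hh ?_ hν
  rw [← Algebra.algebraMap_eq_smul_one, ← Algebra.algebraMap_eq_smul_one,
    algebraMap_le_iff_le_spectrum, le_algebraMap_iff_spectrum_le] at hCh
  exact hCh.imp (fun h => h x hx) (fun h => h x hx)

/-- Comparing through scalars gives `B ≤ (b / a) A` or `(a / b) A ≤ B`; conjugation by `A ^ (-1/2)`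
turns `A` into `1`. -/
theorem conj_half_bound {𝔄 : Type*} [CStarAlgebra 𝔄] [PartialOrder 𝔄]
    [StarOrderedRing 𝔄] {A B : 𝔄} {a b : ℝ} (ha : 0 < a) (hb : 0 < b)
    (hA : IsStrictlyPositive A)
    (hAB : (B ≤ b • (1 : 𝔄) ∧ a • (1 : 𝔄) ≤ A) ∨ (A ≤ b • (1 : 𝔄) ∧ a • (1 : 𝔄) ≤ B)) :
    A ^ (-1 / 2 : ℝ) * B * A ^ (-1 / 2 : ℝ) ≤ (a / b)⁻¹ • (1 : 𝔄) ∨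
      (a / b) • (1 : 𝔄) ≤ A ^ (-1 / 2 : ℝ) * B * A ^ (-1 / 2 : ℝ) := by
  have hone : A ^ (-1 / 2 : ℝ) * A * A ^ (-1 / 2 : ℝ) = 1 := by
    have := CFC.conjugate_rpow_neg_one_half A hA
    rwa [← neg_div] at this
  have key : ∀ {X Y : 𝔄}, X ≤ Y → A ^ (-1 / 2 : ℝ) * X * A ^ (-1 / 2 : ℝ) ≤
      A ^ (-1 / 2 : ℝ) * Y * A ^ (-1 / 2 : ℝ) :=
    fun h => conjugate_le_conjugate_of_nonneg h CFC.rpow_nonneg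
  refine hAB.imp (fun h => ?_) (fun h => ?_)
  · have h1 : B ≤ (a / b)⁻¹ • A := by
      refine h.1.trans ?_
      have := smul_le_smul_of_nonneg_left h.2 (show 0 ≤ (a / b)⁻¹ by positivity)
      rwa [smul_smul, show (a / b)⁻¹ * a = b by field_simp] at this
    simpa only [mul_smul_comm, smul_mul_assoc, hone] using key h1
  · have h1 : (a / b) • A ≤ B := by
      refine le_trans ?_ h.2
      have := smul_le_smul_of_nonneg_left h.1 (show 0 ≤ a / b by positivity)
      rwa [smul_smul, show a / b * b = a by field_simp] at this
    simpa only [mul_smul_comm, smul_mul_assoc, hone] using key h1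

/-- The refined operator Young inequality of Zuo, Shi and Fujii, for inverses. -/
theorem smul_wGeomMean_inv_le {A B : H →L[ℂ] H} {a b ν : ℝ} (hb : 0 < b) (hab : b ≤ a)
    (hA : IsStrictlyPositive A) (hB : IsStrictlyPositive B)
    (hAB : (B ≤ b • (1 : H →L[ℂ] H) ∧ a • (1 : H →L[ℂ] H) ≤ A) ∨
      (A ≤ b • (1 : H →L[ℂ] H) ∧ a • (1 : H →L[ℂ] H) ≤ B))
    (hν : ν ∈ Set.Icc (0 : ℝ) 1) :
    kantorovich (a / b) ^ min ν (1 - ν) • wGeomMean ν A B ^ (-1 : ℝ) ≤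
      (1 - ν) • A ^ (-1 : ℝ) + ν • B ^ (-1 : ℝ) := by
  have hC := isStrictlyPositive_conj_rpow hA hB (-1 / 2)
  have h1 := smul_rpow_neg_le hC ((one_le_div hb).2 hab)
    (conj_half_bound (hb.trans_le hab) hb hA hAB) hν
  -- This conjugation sends `1`, `C⁻¹`, `C ^ (-ν)` to `A⁻¹`, `B⁻¹`, `(A # B)⁻¹`, where `C` is the
  -- conjugate of `B` in `hC`.
  have h2 := conjugate_le_conjugate_of_nonneg h1 (c := A ^ (-1 / 2 : ℝ)) CFC.rpow_nonneg
  have hBC : A ^ (1 / 2 : ℝ) * (A ^ (-1 / 2 : ℝ) * B * A ^ (-1 / 2 : ℝ)) * A ^ (1 / 2 : ℝ) = B := by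
    have e1 : A ^ (1 / 2 : ℝ) * A ^ (-1 / 2 : ℝ) = 1 := by
      rw [neg_div]; exact CFC.rpow_mul_rpow_neg _ hA
    have e2 : A ^ (-1 / 2 : ℝ) * A ^ (1 / 2 : ℝ) = 1 := by
      rw [neg_div]; exact CFC.rpow_neg_mul_rpow _ hA
    calc _ = (A ^ (1 / 2 : ℝ) * A ^ (-1 / 2 : ℝ)) * B * (A ^ (-1 / 2 : ℝ) * A ^ (1 / 2 : ℝ)) := by
          simp only [mul_assoc]
      _ = B := by rw [e1, e2, one_mul, mul_one]
  have hBi := conj_rpow_neg_one hA hC (hBC.symm ▸ hB)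
  rw [hBC] at hBi
  have hAi : A ^ (-1 / 2 : ℝ) * A ^ (-1 / 2 : ℝ) = A ^ (-1 : ℝ) := by
    rw [← CFC.rpow_add hA.isUnit]; norm_num
  rw [mul_add, add_mul] at h2
  simp only [mul_smul_comm, smul_mul_assoc, mul_one] at h2
  rwa [← wGeomMean_rpow_neg_one hA hB, hAi, ← hBi] at h2

end Mean

/-! ### Choi's inequality by finite positive decompositions. -/

/-- A partition of unity on `[m, M]` with positive nodes that reproduces `x` and `x⁻¹`
up to `ε`. -/
theorem exists_partition_approx_id_inv {m M ε : ℝ} (hm : 0 < m) (hmM : m < M) (hε : 0 < ε) :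
    ∃ (n : ℕ) (t : Fin (n + 1) → ℝ) (ψ : Fin (n + 1) → ℝ → ℝ),
      (∀ k, 0 < t k) ∧ (∀ k, Continuous (ψ k)) ∧ ∀ x ∈ Set.Icc m M,
        (∀ k, 0 ≤ ψ k x) ∧ ∑ k, ψ k x = 1 ∧ ∑ k, t k * ψ k x ≤ x + ε ∧
          ∑ k, (t k)⁻¹ * ψ k x ≤ x⁻¹ + ε := by
  have hd : 0 < M - m := sub_pos.2 hmM
  have hpos : ∀ x : unitInterval, 0 < m + (M - m) * (x : ℝ) := fun x =>
    add_pos_of_pos_of_nonneg hm (mul_nonneg hd.le x.2.1)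
  let f : C(unitInterval, ℝ) := ⟨fun x => m + (M - m) * (x : ℝ), by fun_prop⟩
  let g : C(unitInterval, ℝ) := ⟨fun x => (m + (M - m) * (x : ℝ))⁻¹,
    Continuous.inv₀ (by fun_prop) fun x => (hpos x).ne'⟩
  -- One Bernstein degree `n` serves both `x` and `x⁻¹`, transported to the unit interval.
  obtain ⟨n, hf, hg⟩ := (((Metric.tendsto_nhds.1 (bernsteinApproximation_uniform f)) ε hε).and
    ((Metric.tendsto_nhds.1 (bernsteinApproximation_uniform g)) ε hε)).exists
  refine ⟨n, fun k => f (bernstein.z k),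
    fun k x => (bernsteinPolynomial ℝ n k).eval ((x - m) / (M - m)), fun k => hpos _,
    fun k => by fun_prop, fun x hx => ?_⟩
  let y : unitInterval := ⟨(x - m) / (M - m), div_nonneg (by linarith [hx.1]) hd.le,
    (div_le_one hd).2 (by linarith [hx.2])⟩
  have hy : ∀ k : Fin (n + 1),
      (bernsteinPolynomial ℝ n k).eval ((x - m) / (M - m)) = bernstein n k y := fun k => rfl
  have hfy : f y = x := by
    change m + (M - m) * ((x - m) / (M - m)) = x
    field_simp; ring
  have hgy : g y = x⁻¹ := congrArg (·⁻¹) hfy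
  simp only [hy]
  refine ⟨fun k => bernstein_nonneg, bernstein.probability n y, ?_, ?_⟩
  · have h := (ContinuousMap.dist_apply_le_dist y).trans_lt hf
    rw [Real.dist_eq, bernsteinApproximation.apply, hfy] at h
    have h' := (abs_lt.1 h).2
    simp only [smul_eq_mul, mul_comm (bernstein _ _ _)] at h'
    linarith
  · have h := (ContinuousMap.dist_apply_le_dist y).trans_lt hg
    rw [Real.dist_eq, bernsteinApproximation.apply, hgy] at h
    have h' := (abs_lt.1 h).2
    simp only [smul_eq_mul, mul_comm (bernstein _ _ _)] at h'
    have h2 : ∑ k : Fin (n + 1), (f (bernstein.z k))⁻¹ * bernstein n k y =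
      ∑ k : Fin (n + 1), g (bernstein.z k) * bernstein n k y := rfl
    linarith

/-- A discrete stand-in for the spectral measure of `X`: mere positivity of `Φ` suffices because
only the single operators `Φ (F k)` are tested. -/
theorem exists_partition_approx_self_inv {𝔄 : Type*} [CStarAlgebra 𝔄] [PartialOrder 𝔄]
    [StarOrderedRing 𝔄] {X : 𝔄} {m M ε : ℝ} (hm : 0 < m) (hmM : m < M) (hε : 0 < ε)
    (h : m • (1 : 𝔄) ≤ X) (h' : X ≤ M • (1 : 𝔄)) :
    ∃ (n : ℕ) (t : Fin (n + 1) → ℝ) (F : Fin (n + 1) → 𝔄),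
      (∀ k, 0 < t k) ∧ (∀ k, 0 ≤ F k) ∧ ∑ k, F k = 1 ∧
        ∑ k, t k • F k ≤ X + ε • (1 : 𝔄) ∧
        ∑ k, (t k)⁻¹ • F k ≤ X ^ (-1 : ℝ) + ε • (1 : 𝔄) := by
  have hX := isStrictlyPositive_of_smul_one_le hm h
  have hsa : IsSelfAdjoint X := .of_nonneg hX.nonneg
  have hsp := (spectrum_subset_Icc_iff hsa).1 ⟨h, h'⟩
  have hc := hX.continuousOn_rpow (-1)
  obtain ⟨n, t, ψ, ht, hψ, H⟩ := exists_partition_approx_id_inv hm hmM hε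
  have hsum : ∀ c : Fin (n + 1) → ℝ, ∑ k, c k • cfc (ψ k) X =
      cfc (fun x => ∑ k, c k * ψ k x) X := by
    intro c
    have := cfc_sum (fun k x => c k * ψ k x) X Finset.univ (fun k _ => by fun_prop)
    rw [show (fun x => ∑ k, c k * ψ k x) = ∑ k, fun x => c k * ψ k x by ext; simp, this]
    exact Finset.sum_congr rfl fun k _ => (cfc_const_mul _ _ _ (by fun_prop)).symm
  have hcont : ∀ c : Fin (n + 1) → ℝ,
      ContinuousOn (fun x => ∑ k, c k * ψ k x) (spectrum ℝ X) := fun c => by fun_prop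
  have hXε : X + ε • (1 : 𝔄) = cfc (fun x : ℝ => x + ε) X := by
    rw [cfc_add_const ε (fun x : ℝ => x) X (continuousOn_id' _), cfc_id' ℝ X,
      Algebra.algebraMap_eq_smul_one]
  have hXiε : X ^ (-1 : ℝ) + ε • (1 : 𝔄) = cfc (fun x : ℝ => x ^ (-1 : ℝ) + ε) X := by
    rw [cfc_add_const ε (fun x : ℝ => x ^ (-1 : ℝ)) X hc, ← CFC.rpow_eq_cfc_real hX.nonneg,
      Algebra.algebraMap_eq_smul_one]
  refine ⟨n, t, fun k => cfc (ψ k) X, ht, fun k => cfc_nonneg fun x hx => (H x (hsp hx)).1 k,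
    ?_, ?_, ?_⟩
  · have h1 := hsum fun _ => 1
    simp only [one_smul, one_mul] at h1
    rw [h1, ← cfc_const_one ℝ X]
    exact cfc_congr fun x hx => (H x (hsp hx)).2.1
  · rw [hsum, hXε]
    exact cfc_mono (fun x hx => (H x (hsp hx)).2.2.1) (hcont t) (by fun_prop)
  · rw [hsum, hXiε]
    exact cfc_mono (fun x hx => by
      rw [Real.rpow_neg_one]; exact (H x (hsp hx)).2.2.2) (hcont _) (by fun_prop)

theorem map_smul_real {H : Type*} [NormedAddCommGroup H] [InnerProductSpace ℂ H]
    {K : Type*} [NormedAddCommGroup K] [InnerProductSpace ℂ K]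
    {Φ : (H →L[ℂ] H) →ₗ[ℂ] (K →L[ℂ] K)} (r : ℝ) (X : H →L[ℂ] H) : Φ (r • X) = r • Φ X :=
  Φ.map_smul_of_tower r X

section PositiveMap

variable {H : Type*} [NormedAddCommGroup H] [InnerProductSpace ℂ H] [CompleteSpace H]
  {K : Type*} [NormedAddCommGroup K] [InnerProductSpace ℂ K] [CompleteSpace K]
  {Φ : (H →L[ℂ] H) →ₗ[ℂ] (K →L[ℂ] K)}

theorem map_le_map_of_positive (hΦ : ∀ X : H →L[ℂ] H, 0 ≤ X → 0 ≤ Φ X) {X Y : H →L[ℂ] H}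
    (h : X ≤ Y) : Φ X ≤ Φ Y := by
  have := hΦ _ (sub_nonneg.2 h)
  rwa [map_sub, sub_nonneg] at this

/-- Positivity of the operator matrix with rows `(Φ(X⁻¹), 1)` and `(1, Φ(X))`, up to `ε`. -/
theorem inner_map_inv_add_nonneg_approx (hΦ : ∀ X : H →L[ℂ] H, 0 ≤ X → 0 ≤ Φ X) (hΦ1 : Φ 1 = 1)
    {X : H →L[ℂ] H} {m M ε : ℝ} (hm : 0 < m) (hmM : m < M) (hε : 0 < ε)
    (h : m • (1 : H →L[ℂ] H) ≤ X) (h' : X ≤ M • (1 : H →L[ℂ] H)) (u v : K) :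
    0 ≤ (⟪Φ (X ^ (-1 : ℝ)) u, u⟫_ℂ).re + 2 * (⟪u, v⟫_ℂ).re + (⟪Φ X v, v⟫_ℂ).re +
      ε * (‖u‖ ^ 2 + ‖v‖ ^ 2) := by
  obtain ⟨n, t, F, ht, hF, h1, h2, h3⟩ := exists_partition_approx_self_inv hm hmM hε h h'
  have hsm : ∀ (r : ℝ) (T : K →L[ℂ] K) (w : K),
      (⟪(r • T) w, w⟫_ℂ).re = r * (⟪T w, w⟫_ℂ).re := by
    intro r T w
    rw [smul_apply, ← Complex.coe_smul, inner_smul_left, Complex.conj_ofReal,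
      Complex.re_ofReal_mul]
  have hsum : ∀ (T : Fin (n + 1) → (K →L[ℂ] K)) (w z : K),
      (⟪(∑ k, T k) w, z⟫_ℂ).re = ∑ k, (⟪T k w, z⟫_ℂ).re := by
    intro T w z
    rw [sum_apply, sum_inner, Complex.re_sum]
  have e1 : ∑ k, (⟪Φ (F k) u, v⟫_ℂ).re = (⟪u, v⟫_ℂ).re := by
    rw [← hsum, ← map_sum, h1, hΦ1, one_apply_eq_self]
  have e2 : ∑ k, t k * (⟪Φ (F k) v, v⟫_ℂ).re ≤ (⟪Φ X v, v⟫_ℂ).re + ε * ‖v‖ ^ 2 := by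
    have := re_inner_le_of_le (map_le_map_of_positive hΦ h2) v
    simpa only [map_sum, map_smul_real, map_add, hΦ1, hsum, hsm, add_apply, inner_add_left,
      Complex.add_re, one_apply_eq_self, re_inner_self_eq_norm_sq] using this
  have e3 : ∑ k, (t k)⁻¹ * (⟪Φ (F k) u, u⟫_ℂ).re ≤
      (⟪Φ (X ^ (-1 : ℝ)) u, u⟫_ℂ).re + ε * ‖u‖ ^ 2 := by
    have := re_inner_le_of_le (map_le_map_of_positive hΦ h3) u
    simpa only [map_sum, map_smul_real, map_add, hΦ1, hsum, hsm, add_apply, inner_add_left,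
      Complex.add_re, one_apply_eq_self, re_inner_self_eq_norm_sq] using this
  have e4 : ∀ k, 0 ≤ (t k)⁻¹ * (⟪Φ (F k) u, u⟫_ℂ).re + 2 * (⟪Φ (F k) u, v⟫_ℂ).re +
      t k * (⟪Φ (F k) v, v⟫_ℂ).re := by
    intro k
    have hk := hΦ _ (hF k)
    -- The matrix with rows `(t⁻¹, 1)` and `(1, t)` has rank one, so its form is `t⁻¹` times a
    -- single value of the form of `Φ (F k)`.
    have h5 := re_inner_nonneg_of_nonneg hk (u + ((t k : ℝ) : ℂ) • v)
    have h6 : (⟪Φ (F k) v, u⟫_ℂ).re = (⟪Φ (F k) u, v⟫_ℂ).re := by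
      rw [inner_apply_comm_of_nonneg hk, re_inner_comm]
    simp only [map_add, map_smul, inner_add_left, inner_add_right, inner_smul_left,
      inner_smul_right, Complex.conj_ofReal, Complex.add_re, Complex.re_ofReal_mul, h6] at h5
    have h7 := mul_nonneg (inv_pos.2 (ht k)).le h5
    have h8 : (t k)⁻¹ * t k = 1 := inv_mul_cancel₀ (ht k).ne'
    linear_combination h7 + (2 * (⟪Φ (F k) u, v⟫_ℂ).re + t k * (⟪Φ (F k) v, v⟫_ℂ).re) * h8
  have e5 := Finset.sum_nonneg fun k (_ : k ∈ Finset.univ) => e4 k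
  rw [Finset.sum_add_distrib, Finset.sum_add_distrib, ← Finset.mul_sum, e1] at e5
  linarith

theorem inner_map_inv_add_nonneg (hΦ : ∀ X : H →L[ℂ] H, 0 ≤ X → 0 ≤ Φ X) (hΦ1 : Φ 1 = 1)
    {X : H →L[ℂ] H} {m M : ℝ} (hm : 0 < m) (hmM : m < M)
    (h : m • (1 : H →L[ℂ] H) ≤ X) (h' : X ≤ M • (1 : H →L[ℂ] H)) (u v : K) :
    0 ≤ (⟪Φ (X ^ (-1 : ℝ)) u, u⟫_ℂ).re + 2 * (⟪u, v⟫_ℂ).re + (⟪Φ X v, v⟫_ℂ).re := by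
  have hlim : Filter.Tendsto (fun ε : ℝ => (⟪Φ (X ^ (-1 : ℝ)) u, u⟫_ℂ).re +
      2 * (⟪u, v⟫_ℂ).re + (⟪Φ X v, v⟫_ℂ).re + ε * (‖u‖ ^ 2 + ‖v‖ ^ 2))
      (nhdsWithin 0 (Set.Ioi 0)) (nhds ((⟪Φ (X ^ (-1 : ℝ)) u, u⟫_ℂ).re +
      2 * (⟪u, v⟫_ℂ).re + (⟪Φ X v, v⟫_ℂ).re + 0 * (‖u‖ ^ 2 + ‖v‖ ^ 2))) :=
    (Continuous.tendsto (by fun_prop) 0).mono_left nhdsWithin_le_nhds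
  rw [zero_mul, add_zero] at hlim
  exact ge_of_tendsto hlim (Filter.eventually_of_mem self_mem_nhdsWithin fun ε hε =>
    inner_map_inv_add_nonneg_approx hΦ hΦ1 hm hmM hε h h' u v)

theorem smul_one_le_map (hΦ : ∀ X : H →L[ℂ] H, 0 ≤ X → 0 ≤ Φ X) (hΦ1 : Φ 1 = 1)
    {X : H →L[ℂ] H} {m : ℝ} (h : m • (1 : H →L[ℂ] H) ≤ X) : m • (1 : K →L[ℂ] K) ≤ Φ X := by
  have := map_le_map_of_positive hΦ h
  rwa [map_smul_real, hΦ1] at this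

theorem map_le_smul_one (hΦ : ∀ X : H →L[ℂ] H, 0 ≤ X → 0 ≤ Φ X) (hΦ1 : Φ 1 = 1)
    {X : H →L[ℂ] H} {M : ℝ} (h : X ≤ M • (1 : H →L[ℂ] H)) : Φ X ≤ M • (1 : K →L[ℂ] K) := by
  have := map_le_map_of_positive hΦ h
  rwa [map_smul_real, hΦ1] at this

/-- Choi's inequality `Φ(X)⁻¹ ≤ Φ(X⁻¹)` for a positive unital map. -/
theorem map_rpow_neg_one_le (hΦ : ∀ X : H →L[ℂ] H, 0 ≤ X → 0 ≤ Φ X) (hΦ1 : Φ 1 = 1)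
    {X : H →L[ℂ] H} {m M : ℝ} (hm : 0 < m) (hmM : m < M)
    (h : m • (1 : H →L[ℂ] H) ≤ X) (h' : X ≤ M • (1 : H →L[ℂ] H)) :
    Φ X ^ (-1 : ℝ) ≤ Φ (X ^ (-1 : ℝ)) := by
  have hP := isStrictlyPositive_of_smul_one_le hm (smul_one_le_map hΦ hΦ1 h)
  have hPi : 0 ≤ Φ X ^ (-1 : ℝ) := CFC.rpow_nonneg
  have hXi : 0 ≤ Φ (X ^ (-1 : ℝ)) := hΦ _ CFC.rpow_nonneg
  have hsa : IsSelfAdjoint (Φ (X ^ (-1 : ℝ)) - Φ X ^ (-1 : ℝ)) :=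
    (IsSelfAdjoint.of_nonneg hXi).sub (IsSelfAdjoint.of_nonneg hPi)
  rw [ContinuousLinearMap.le_def, ContinuousLinearMap.isPositive_def']
  refine ⟨hsa, fun u => ?_⟩
  -- The minimizing `v`, as for a Schur complement.
  have h1 := inner_map_inv_add_nonneg hΦ hΦ1 hm hmM h h' u (-(Φ X ^ (-1 : ℝ)) u)
  have h2 : Φ X ((Φ X ^ (-1 : ℝ)) u) = u := by
    have := CFC.rpow_mul_rpow_neg 1 hP
    rw [CFC.rpow_one _ hP.nonneg] at this
    exact congrArg (fun T : K →L[ℂ] K => T u) this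
  have h3 := re_inner_comm u ((Φ X ^ (-1 : ℝ)) u)
  simp only [map_neg, inner_neg_left, inner_neg_right, neg_neg, Complex.neg_re,
    h2, h3] at h1
  rw [ContinuousLinearMap.reApplyInnerSelf_apply, sub_apply, inner_sub_left,
    RCLike.re_eq_complex_re, Complex.sub_re]
  linarith

end PositiveMap

/-! ### Constants and assembly. -/

theorem le_of_smul_one_le_of_le_smul_one {𝔄 : Type*} [CStarAlgebra 𝔄] [PartialOrder 𝔄]
    [StarOrderedRing 𝔄] [Nontrivial 𝔄] {a : 𝔄} {m M : ℝ} (hm : m • (1 : 𝔄) ≤ a)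
    (hM : a ≤ M • (1 : 𝔄)) : m ≤ M := by
  have hsa : IsSelfAdjoint a := by
    have h1 : IsSelfAdjoint (a - m • (1 : 𝔄)) := .of_nonneg (sub_nonneg.2 hm)
    have h2 : IsSelfAdjoint (m • (1 : 𝔄)) := (IsSelfAdjoint.all m).smul (.one 𝔄)
    simpa using h1.add h2
  obtain ⟨x, hx⟩ := ContinuousFunctionalCalculus.spectrum_nonempty (R := ℝ) a hsa
  have := (spectrum_subset_Icc_iff hsa).1 ⟨hm, hM⟩ hx
  exact this.1.trans this.2

/-- `K(M/m) = (m + M)² / (4 m M)` and `(4 ^ (2/p)) ^ p = 16`. -/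
theorem kantorovich_const_eq {m M k p : ℝ} (hm : 0 < m) (hM : 0 < M) (hk : 0 < k) (hp : 0 < p) :
    ((m + M) ^ 2 / (m * M * k)) ^ p / 16 =
      (kantorovich (M / m) / ((4 : ℝ) ^ (2 / p - 1) * k)) ^ p := by
  have h1 : kantorovich (M / m) / ((4 : ℝ) ^ (2 / p - 1) * k) =
      (m + M) ^ 2 / (m * M * k) / (4 : ℝ) ^ (2 / p) := by
    have h4 : 0 < (4 : ℝ) ^ (2 / p) := by positivity
    rw [kantorovich, Real.rpow_sub (by norm_num), Real.rpow_one]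
    field_simp
    ring
  rw [h1, Real.div_rpow (y := (4 : ℝ) ^ (2 / p)) (by positivity) (by positivity), ← Real.rpow_mul (by norm_num),
    div_mul_cancel₀ _ hp.ne']
  norm_num

section PositiveMap

variable {H : Type*} [NormedAddCommGroup H] [InnerProductSpace ℂ H] [CompleteSpace H]
  {K : Type*} [NormedAddCommGroup K] [InnerProductSpace ℂ K] [CompleteSpace K]
  {Φ : (H →L[ℂ] H) →ₗ[ℂ] (K →L[ℂ] K)}

theorem map_add_smul_map_inv_le (hΦ : ∀ X : H →L[ℂ] H, 0 ≤ X → 0 ≤ Φ X) (hΦ1 : Φ 1 = 1)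
    {X : H →L[ℂ] H} {m M : ℝ} (hm : 0 < m) (h : m • (1 : H →L[ℂ] H) ≤ X)
    (h' : X ≤ M • (1 : H →L[ℂ] H)) :
    Φ X + (m * M) • Φ (X ^ (-1 : ℝ)) ≤ (m + M) • (1 : K →L[ℂ] K) := by
  have := map_le_smul_one hΦ hΦ1 (add_smul_rpow_neg_one_le hm h h')
  rwa [map_add, map_smul_real] at this

theorem map_wArithMean {H : Type*} [NormedAddCommGroup H] [InnerProductSpace ℂ H]
    {K : Type*} [NormedAddCommGroup K] [InnerProductSpace ℂ K]
    {Φ : (H →L[ℂ] H) →ₗ[ℂ] (K →L[ℂ] K)} (ν : ℝ) (A B : H →L[ℂ] H) :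
    Φ (wArithMean ν A B) = (1 - ν) • Φ A + ν • Φ B := by
  rw [wArithMean, map_add, map_smul_real, map_smul_real]

theorem smul_one_le_wArithMean {ν : ℝ} (hν : ν ∈ Set.Icc (0 : ℝ) 1) {A B : H →L[ℂ] H} {m : ℝ}
    (hA : m • (1 : H →L[ℂ] H) ≤ A) (hB : m • (1 : H →L[ℂ] H) ≤ B) :
    m • (1 : H →L[ℂ] H) ≤ wArithMean ν A B := by
  have := add_le_add (smul_le_smul_of_nonneg_left hA (sub_nonneg.2 hν.2))
    (smul_le_smul_of_nonneg_left hB hν.1)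
  rwa [← add_smul, sub_add_cancel, one_smul] at this

/-- The power inequality for any `G` whose inverse is dominated by the arithmetic mean of
`Φ(A⁻¹)` and `Φ(B⁻¹)`. -/
theorem map_wArithMean_rpow_le (hΦ : ∀ X : H →L[ℂ] H, 0 ≤ X → 0 ≤ Φ X) (hΦ1 : Φ 1 = 1)
    {A B : H →L[ℂ] H} {m M : ℝ} (hm : 0 < m) (hM : 0 < M)
    (hmA : m • (1 : H →L[ℂ] H) ≤ A) (hAM : A ≤ M • (1 : H →L[ℂ] H))
    (hmB : m • (1 : H →L[ℂ] H) ≤ B) (hBM : B ≤ M • (1 : H →L[ℂ] H))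
    {p ν k : ℝ} (hp : 2 ≤ p) (hν : ν ∈ Set.Icc (0 : ℝ) 1) (hk : 0 < k)
    {G : K →L[ℂ] K} (hG : IsStrictlyPositive G)
    (hkG : k • G ^ (-1 : ℝ) ≤ (1 - ν) • Φ (A ^ (-1 : ℝ)) + ν • Φ (B ^ (-1 : ℝ))) :
    Φ (wArithMean ν A B) ^ p ≤
      (kantorovich (M / m) / ((4 : ℝ) ^ (2 / p - 1) * k)) ^ p • G ^ p := by
  have hP : IsStrictlyPositive (Φ (wArithMean ν A B)) := isStrictlyPositive_of_smul_one_le hm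
    (smul_one_le_map hΦ hΦ1 (smul_one_le_wArithMean hν hmA hmB))
  have hA := smul_le_smul_of_nonneg_left (map_add_smul_map_inv_le hΦ hΦ1 hm hmA hAM)
    (sub_nonneg.2 hν.2)
  have hB := smul_le_smul_of_nonneg_left (map_add_smul_map_inv_le hΦ hΦ1 hm hmB hBM) hν.1
  have hkG' := smul_le_smul_of_nonneg_left hkG (mul_pos hm hM).le
  have hsum : Φ (wArithMean ν A B) + (m * M * k) • G ^ (-1 : ℝ) ≤ (m + M) • (1 : K →L[ℂ] K) := by
    rw [mul_smul]
    refine (add_le_add_right hkG' _).trans ?_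
    have hAB := add_le_add hA hB
    rw [← add_smul, sub_add_cancel, one_smul] at hAB
    refine le_trans (le_of_eq ?_) hAB
    rw [map_wArithMean]
    module
  rw [← kantorovich_const_eq hm hM hk (by linarith)]
  exact rpow_le_smul_rpow_of_add_smul_inv_le hP hG (by positivity) (by positivity) hp hsum

/-- Both estimates, once `A` and `B` are known to lie in `[m, M]` and to be separated. -/
theorem map_wArithMean_rpow_le_wGeomMean (hΦ : ∀ X : H →L[ℂ] H, 0 ≤ X → 0 ≤ Φ X) (hΦ1 : Φ 1 = 1)
    {A B : H →L[ℂ] H} {m m' M' M : ℝ} (hm : 0 < m) (hmM : m < M) (hm' : 0 < m') (hmM' : m' ≤ M')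
    (hmA : m • (1 : H →L[ℂ] H) ≤ A) (hAM : A ≤ M • (1 : H →L[ℂ] H))
    (hmB : m • (1 : H →L[ℂ] H) ≤ B) (hBM : B ≤ M • (1 : H →L[ℂ] H))
    (hAB : (B ≤ m' • (1 : H →L[ℂ] H) ∧ M' • (1 : H →L[ℂ] H) ≤ A) ∨
      (A ≤ m' • (1 : H →L[ℂ] H) ∧ M' • (1 : H →L[ℂ] H) ≤ B))
    {p ν : ℝ} (hp : 2 ≤ p) (hν : ν ∈ Set.Icc (0 : ℝ) 1) :
    Φ (wArithMean ν A B) ^ p ≤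
        (kantorovich (M / m) /
          ((4 : ℝ) ^ (2 / p - 1) * kantorovich (M' / m') ^ min ν (1 - ν))) ^ p •
          Φ (wGeomMean ν A B) ^ p ∧
      Φ (wArithMean ν A B) ^ p ≤
        (kantorovich (M / m) /
          ((4 : ℝ) ^ (2 / p - 1) * kantorovich (M' / m') ^ min ν (1 - ν))) ^ p •
          wGeomMean ν (Φ A) (Φ B) ^ p := by
  have hA := isStrictlyPositive_of_smul_one_le hm hmA
  have hB := isStrictlyPositive_of_smul_one_le hm hmB
  have hΦA := isStrictlyPositive_of_smul_one_le hm (smul_one_le_map hΦ hΦ1 hmA)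
  have hΦB := isStrictlyPositive_of_smul_one_le hm (smul_one_le_map hΦ hΦ1 hmB)
  have hk : 0 < kantorovich (M' / m') ^ min ν (1 - ν) := by
    have : 0 < M' := hm'.trans_le hmM'
    unfold kantorovich; positivity
  constructor
  -- Young for `A, B`, then `Φ`, then Choi for `A # B`.
  · have hG := isStrictlyPositive_wGeomMean hA hB ν
    have hy := map_le_map_of_positive hΦ (smul_wGeomMean_inv_le hm' hmM' hA hB hAB hν)
    rw [map_add, map_smul_real, map_smul_real, map_smul_real] at hy
    rcases subsingleton_or_nontrivial (H →L[ℂ] H) with hs | hs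
    · have h01 : (1 : K →L[ℂ] K) = 0 := by
        rw [← hΦ1, Subsingleton.elim (1 : H →L[ℂ] H) 0, map_zero]
      have := subsingleton_of_zero_eq_one h01.symm
      exact (Subsingleton.elim _ _).le
    obtain ⟨a, ha, haG⟩ := (CFC.exists_pos_algebraMap_le_iff
      (IsSelfAdjoint.of_nonneg hG.nonneg)).2 fun x hx => hG.pos_of_mem_spectrum hx
    rw [Algebra.algebraMap_eq_smul_one] at haG
    have hGb := (IsSelfAdjoint.of_nonneg hG.nonneg).le_algebraMap_norm_self
    rw [Algebra.algebraMap_eq_smul_one] at hGb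
    -- The `+ 1` makes the interval for Choi's inequality nondegenerate.
    have hGb' : wGeomMean ν A B ≤ (‖wGeomMean ν A B‖ + 1) • (1 : H →L[ℂ] H) := by
      rw [add_smul, one_smul]
      exact hGb.trans (le_add_of_nonneg_right zero_le_one)
    have hab := le_of_smul_one_le_of_le_smul_one haG hGb
    have hc := map_rpow_neg_one_le hΦ hΦ1 ha (hab.trans_lt (lt_add_one _)) haG hGb'
    exact map_wArithMean_rpow_le hΦ hΦ1 hm (hm.trans hmM) hmA hAM hmB hBM hp hν hk
      (isStrictlyPositive_of_smul_one_le ha (smul_one_le_map hΦ hΦ1 haG))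
      ((smul_le_smul_of_nonneg_left hc hk.le).trans hy)
  -- Here Young is used for `Φ A, Φ B`, and Choi for `A` and `B` separately.
  · have hAB' : (Φ B ≤ m' • (1 : K →L[ℂ] K) ∧ M' • (1 : K →L[ℂ] K) ≤ Φ A) ∨
        (Φ A ≤ m' • (1 : K →L[ℂ] K) ∧ M' • (1 : K →L[ℂ] K) ≤ Φ B) :=
      hAB.imp (fun h => ⟨map_le_smul_one hΦ hΦ1 h.1, smul_one_le_map hΦ hΦ1 h.2⟩)
        (fun h => ⟨map_le_smul_one hΦ hΦ1 h.1, smul_one_le_map hΦ hΦ1 h.2⟩)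
    have hy := smul_wGeomMean_inv_le hm' hmM' hΦA hΦB hAB' hν
    have hcA := map_rpow_neg_one_le hΦ hΦ1 hm hmM hmA hAM
    have hcB := map_rpow_neg_one_le hΦ hΦ1 hm hmM hmB hBM
    exact map_wArithMean_rpow_le hΦ hΦ1 hm (hm.trans hmM) hmA hAM hmB hBM hp hν hk
      (isStrictlyPositive_wGeomMean hΦA hΦB ν)
      (hy.trans (add_le_add (smul_le_smul_of_nonneg_left hcA (sub_nonneg.2 hν.2))
        (smul_le_smul_of_nonneg_left hcB hν.1)))

end PositiveMap

theorem mainTheorem2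
    {H : Type*} [NormedAddCommGroup H] [InnerProductSpace ℂ H] [CompleteSpace H]
    {K : Type*} [NormedAddCommGroup K] [InnerProductSpace ℂ K] [CompleteSpace K]
    (Φ : (H →L[ℂ] H) →ₗ[ℂ] (K →L[ℂ] K))
    (hΦpos : ∀ X : H →L[ℂ] H, 0 ≤ X → 0 ≤ Φ X)
    (hΦunital : Φ 1 = 1)
    (A B : H →L[ℂ] H) (m m' M' M : ℝ) (hm : 0 < m) (hm'M' : m' < M')
    (hAB : (m • (1 : H →L[ℂ] H) ≤ B ∧ B ≤ m' • (1 : H →L[ℂ] H) ∧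
          M' • (1 : H →L[ℂ] H) ≤ A ∧ A ≤ M • (1 : H →L[ℂ] H)) ∨
        (m • (1 : H →L[ℂ] H) ≤ A ∧ A ≤ m' • (1 : H →L[ℂ] H) ∧
          M' • (1 : H →L[ℂ] H) ≤ B ∧ B ≤ M • (1 : H →L[ℂ] H)))
    (p ν : ℝ) (hp : 2 ≤ p) (hν : ν ∈ Set.Icc (0 : ℝ) 1) :
    Φ (wArithMean ν A B) ^ p ≤
        (kantorovich (M / m) /
          ((4 : ℝ) ^ (2 / p - 1) * kantorovich (M' / m') ^ min ν (1 - ν))) ^ p •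
          Φ (wGeomMean ν A B) ^ p ∧
      Φ (wArithMean ν A B) ^ p ≤
        (kantorovich (M / m) /
          ((4 : ℝ) ^ (2 / p - 1) * kantorovich (M' / m') ^ min ν (1 - ν))) ^ p •
          wGeomMean ν (Φ A) (Φ B) ^ p := by
  -- If `H` is trivial, unitality makes `K` trivial; otherwise spectra are nonempty and `m ≤ m'`,
  -- `M' ≤ M` follow.
  rcases subsingleton_or_nontrivial (H →L[ℂ] H) with hs | hs
  · have h01 : (1 : K →L[ℂ] K) = 0 := by
      rw [← hΦunital, Subsingleton.elim (1 : H →L[ℂ] H) 0, map_zero]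
    have := subsingleton_of_zero_eq_one h01.symm
    exact ⟨(Subsingleton.elim _ _).le, (Subsingleton.elim _ _).le⟩
  have hmono : ∀ {a b : ℝ}, a ≤ b → a • (1 : H →L[ℂ] H) ≤ b • (1 : H →L[ℂ] H) :=
    fun h => smul_le_smul_of_nonneg_right h zero_le_one
  have hmm' : m ≤ m' := by
    rcases hAB with ⟨h1, h2, -, -⟩ | ⟨h1, h2, -, -⟩ <;>
      exact le_of_smul_one_le_of_le_smul_one h1 h2
  have hM'M : M' ≤ M := by
    rcases hAB with ⟨-, -, h1, h2⟩ | ⟨-, -, h1, h2⟩ <;>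
      exact le_of_smul_one_le_of_le_smul_one h1 h2
  have hm' : 0 < m' := hm.trans_le hmm'
  have hmM : m < M := by linarith
  rcases hAB with ⟨h1, h2, h3, h4⟩ | ⟨h1, h2, h3, h4⟩
  · exact map_wArithMean_rpow_le_wGeomMean hΦpos hΦunital hm hmM hm' hm'M'.le
      ((hmono (by linarith)).trans h3) h4 h1 (h2.trans (hmono (by linarith)))
      (.inl ⟨h2, h3⟩) hp hν
  · exact map_wArithMean_rpow_le_wGeomMean hΦpos hΦunital hm hmM hm' hm'M'.le
      h1 (h2.trans (hmono (by linarith))) ((hmono (by linarith)).trans h3) h4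
      (.inr ⟨h2, h3⟩) hp hν
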